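/- Let $F$ be the space of finite non-empty subsets of $\mathbb{C}$ with the Vietoris topology (the topology of the Hausdorff metric), which has as a basis the sets $$U_{\{O_i\}_{i\in I},N}=\{A\in F : A\cap O_i\neq\emptyset \text{ for all } i\in I,\ \text{and } A\subseteq N\},$$ where $\{O_i\}_{i\in I}$ is a finite family of open subsets of $\mathbb{C}$ and $N\subseteq\mathbb{C}$ is open. Consider the full topological model over $F$, that is, the Heyting-valued model of set theory over the Heyting algebra of open subsets of $F$; write $U\Vdash\varphi$ if the open set $U$ is contained in the truth value of $\varphi$. In this model, complex numbers are pairs of Dedekind reals, and an open set $N\subseteq\mathbb{C}$ of the ground model is interpreted as the union of the open rational rectangles contained in $N$. Let $H$ be the canonical generic subset of $\mathbb{C}$ in this model, that is, the largest subset of $\mathbb{C}$ such that $U_{\{O_i\}_{i\in I},N}\Vdash H\subseteq N$ for all such $\{O_i\}_{i\in I}$ and $N$; in other words, $H$ consists of the complex numbers of the model that belong to $N$ for every $U_{\{O_i\}_{i\in I},N}$ in the generic filter. Then $$F\Vdash\text{``}H\text{ does not contain any points''},$$ that is, the truth value of $\neg\exists X\,(X\in H)$ is all of $F$. -/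

import Mathlib

open TopologicalSpace
open scoped symmDiff

noncomputable section

/-! ### The Heyting-valued universe over a frame `Ω` -/

/-- Names (terms) for sets in the full Heyting-valued model over `Ω`: a name is a family of names
`elt i`, each one put into the set with truth value `val i`. -/
inductive HName (Ω : Type) : Type 1
  | mk (ι : Type) (elt : ι → HName Ω) (val : ι → Ω) : HName Ω

namespace HName

variable {Ω : Type} [Order.Frame Ω]

/-- The truth value `⟦x = y⟧`: every member of `x` is a member of `y`, and conversely. -/
def eq : HName Ω → HName Ω → Ω
  | mk ι A v, mk κ B w =>
    (⨅ i : ι, v i ⇨ ⨆ j : κ, w j ⊓ eq (A i) (B j)) ⊓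
      (⨅ j : κ, w j ⇨ ⨆ i : ι, v i ⊓ eq (A i) (B j))

/-- The truth value `⟦x ∈ y⟧`. -/
def mem (x : HName Ω) : HName Ω → Ω
  | mk ι A v => ⨆ i : ι, v i ⊓ eq x (A i)

/-- The canonical name of a ground-model set: `x̌ = {⟨⊤, y̌⟩ | y ∈ x}`. -/
def check : PSet.{0} → HName Ω
  | PSet.mk ι A => mk ι (fun i => check (A i)) (fun _ => ⊤)

/-- The unordered pair `{x, y}` in the model. -/
def upair (x y : HName Ω) : HName Ω :=
  mk Bool (fun b => if b then x else y) (fun _ => ⊤)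

/-- The (Kuratowski) ordered pair `(x, y) = {{x, x}, {x, y}}` in the model. -/
def opair (x y : HName Ω) : HName Ω :=
  upair (upair x x) (upair x y)

/-! ### Rationals, Dedekind reals and complex numbers in the model

A rational number is coded by a von Neumann natural number, so `ℚ̌` is the canonical name of a
ground-model set. A quantifier over `ℚ̌` is the supremum or infimum over all `q : ℚ`, and the
decidable relation `q < r` on `ℚ̌` is evaluated in the ground model. -/

/-- The name `q̌` of the rational number `q`. -/
def rat (q : ℚ) : HName Ω := check (PSet.ofNat (Encodable.encode q))

/-- The name of a subset of `ℚ̌`, where `q̌` is put into the set with truth value `f q`. -/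
def ratSubset (f : ℚ → Ω) : HName Ω := mk ℚ rat f

/-- The truth value of "the subsets `L`, `R` of `ℚ̌` are the lower and the upper cut of a Dedekind
real": both are inhabited and rounded, and they are disjoint and located. -/
def isDedekind (L R : HName Ω) : Ω :=
  (⨆ q : ℚ, mem (rat q) L) ⊓ (⨆ q : ℚ, mem (rat q) R) ⊓
  (⨅ q : ℚ, mem (rat q) L ⇔ ⨆ (r : ℚ) (_ : q < r), mem (rat r) L) ⊓
  (⨅ q : ℚ, mem (rat q) R ⇔ ⨆ (r : ℚ) (_ : r < q), mem (rat r) R) ⊓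
  (⨅ q : ℚ, (mem (rat q) L ⊓ mem (rat q) R)ᶜ) ⊓
  (⨅ (q : ℚ) (r : ℚ) (_ : q < r), mem (rat q) L ⊔ mem (rat r) R)

end HName

/-- Two pairs of `Ω`-valued subsets of `ℚ`: the candidates for the lower and upper cuts of the real
and imaginary parts of a complex number in the model. -/
structure ComplexCode (Ω : Type) where
  reL : ℚ → Ω
  reR : ℚ → Ω
  imL : ℚ → Ω
  imR : ℚ → Ω

namespace ComplexCode

open HName

variable {Ω : Type} [Order.Frame Ω]

/-- The name of `((L₁, R₁), (L₂, R₂))`, a pair of pairs of subsets of `ℚ̌`. -/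
def name (z : ComplexCode Ω) : HName Ω :=
  opair (opair (ratSubset z.reL) (ratSubset z.reR)) (opair (ratSubset z.imL) (ratSubset z.imR))

/-- The truth value of "`z` is a complex number", that is, a pair of Dedekind reals. -/
def isComplex (z : ComplexCode Ω) : Ω :=
  isDedekind (ratSubset z.reL) (ratSubset z.reR) ⊓ isDedekind (ratSubset z.imL) (ratSubset z.imR)

/-- The truth value of "the complex number `z` belongs to `N`", where the ground-model open set
`N ⊆ ℂ` is interpreted in the model as the union of the open rational rectangles
`(a, b) × (c, d)` which the ground model sees to be contained in `N`. -/
def inOpen (N : Opens ℂ) (z : ComplexCode Ω) : Ω :=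
  ⨆ (a : ℚ) (b : ℚ) (c : ℚ) (d : ℚ) (_ : a < b) (_ : c < d)
    (_ : Set.Ioo (a : ℝ) b ×ℂ Set.Ioo (c : ℝ) d ⊆ (N : Set ℂ)),
    mem (rat a) (ratSubset z.reL) ⊓ mem (rat b) (ratSubset z.reR) ⊓
      (mem (rat c) (ratSubset z.imL) ⊓ mem (rat d) (ratSubset z.imR))

end ComplexCode

/-! ### The space of finite non-empty sets of complex numbers -/

/-- The finite, non-empty subsets of `ℂ`. -/
def FinSets : Type := {A : Set ℂ // A.Finite ∧ A.Nonempty}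

namespace FinSets

/-- The Vietoris topology. -/
instance : TopologicalSpace FinSets :=
  TopologicalSpace.induced Subtype.val (TopologicalSpace.vietoris ℂ)

/-- The basic open set given by finitely many positive pieces of information `O ∈ P` and one
negative piece of information `N`: it consists of all `A` that meet every `O ∈ P` and satisfy
`A ⊆ N`. -/
def basicOpen (P : Finset (Opens ℂ)) (N : Opens ℂ) : Opens FinSets where
  carrier := {A | (∀ O ∈ P, (A.1 ∩ (O : Set ℂ)).Nonempty) ∧ A.1 ⊆ (N : Set ℂ)}
  is_open' := by
    let _ := TopologicalSpace.vietoris ℂ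
    have hc : Continuous (Subtype.val : FinSets → Set ℂ) := continuous_induced_dom
    have h1 : IsOpen {A : Set ℂ | ∀ O ∈ P, (A ∩ (O : Set ℂ)).Nonempty} := by
      have : {A : Set ℂ | ∀ O ∈ P, (A ∩ (O : Set ℂ)).Nonempty} =
          ⋂ O ∈ P, {A : Set ℂ | (A ∩ (O : Set ℂ)).Nonempty} := by
        ext A; simp
      rw [this]
      exact isOpen_biInter_finset fun O _ => vietoris.isOpen_inter_nonempty_of_isOpen O.isOpen
    exact (h1.inter N.isOpen.powerset_vietoris).preimage hc

/-- `U ⊩ φ`, for a statement `φ` with truth value `p` in the topological model over `FinSets`. -/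
def Forces (U p : Opens FinSets) : Prop := U ≤ p

open ComplexCode

/-- The canonical generic `H ⊆ ℂ`: the set of all complex numbers `z` of the model which belong to
the negative information `N` of every basic open set `U` in the generic filter; the truth value of
"`U` is in the generic filter" is `U` itself. Thus `H` is the largest subset of `ℂ` in the model
such that `U ⊩ H ⊆ N` for every basic open `U` with negative information `N`. -/
def genericH : HName (Opens FinSets) :=
  HName.mk (ComplexCode (Opens FinSets)) name fun z =>
    isComplex z ⊓ ⨅ (P : Finset (Opens ℂ)) (N : Opens ℂ), basicOpen P N ⇨ inOpen N z

end FinSets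

end

/-! A member of `H` with truth value `V` would be a continuous selection on `V`. Over an open set, a
Dedekind complex number of the model is a continuous `ℂ`-valued function, and testing it against
complements of points forces its value at each `B` to lie in `B`. No non-empty open set admits such
a selection (`not_exists_continuousOn_selection`): splitting the chosen point `a` into `a ± w`, for
`w` on a small circle, would select a continuous square root of `w ^ 2` that depends only on the
pair `{w, -w}`. -/

/-- A two-sided cut of rationals is represented by a real number. -/
theorem exists_real_of_dedekind_cut {L R : ℚ → Prop} (hL : ∃ q, L q) (hR : ∃ q, R q)
    (hLo : ∀ q, L q ↔ ∃ r, q < r ∧ L r) (hRo : ∀ q, R q ↔ ∃ r, r < q ∧ R r)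
    (hdisj : ∀ q, ¬ (L q ∧ R q)) (hloc : ∀ q r, q < r → L q ∨ R r) :
    ∃ x : ℝ, (∀ q : ℚ, L q ↔ (q : ℝ) < x) ∧ ∀ q : ℚ, R q ↔ x < (q : ℝ) := by
  have hlt : ∀ q r, L q → R r → q < r := by
    intro q r hq hr
    by_contra! h
    rcases h.eq_or_lt with rfl | h
    · exact hdisj _ ⟨hq, hr⟩
    · exact hdisj r ⟨(hLo r).2 ⟨q, h, hq⟩, hr⟩
  obtain ⟨q₀, hq₀⟩ := hL
  obtain ⟨r₀, hr₀⟩ := hR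
  set S : Set ℝ := (fun q : ℚ => (q : ℝ)) '' {q | L q}
  have hub : ∀ r, R r → (r : ℝ) ∈ upperBounds S := by
    rintro r hr _ ⟨q, hq, rfl⟩
    exact Rat.cast_le.2 (hlt q r hq hr).le
  have hlub : IsLUB S (sSup S) := isLUB_csSup ⟨_, q₀, hq₀, rfl⟩ ⟨_, hub r₀ hr₀⟩
  have hLx : ∀ q, L q ↔ (q : ℝ) < sSup S := by
    intro q
    constructor
    · intro hq
      obtain ⟨r, hqr, hr⟩ := (hLo q).1 hq
      exact lt_of_lt_of_le (Rat.cast_lt.2 hqr) (hlub.1 ⟨r, hr, rfl⟩)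
    · intro hq
      obtain ⟨_, ⟨r, hr, rfl⟩, hqr, -⟩ := hlub.exists_between hq
      exact (hLo q).2 ⟨r, Rat.cast_lt.1 hqr, hr⟩
  refine ⟨sSup S, hLx, fun q => ⟨fun hq => ?_, fun hq => ?_⟩⟩
  · obtain ⟨r, hrq, hr⟩ := (hRo q).1 hq
    exact lt_of_le_of_lt (hlub.2 (hub r hr)) (by exact_mod_cast hrq)
  -- Locatedness at `s < q` leaves only `R q`, since `s` lies above the supremum of `L`.
  · obtain ⟨s, hs, hsq⟩ := exists_rat_btwn hq
    rcases hloc s q (by exact_mod_cast hsq) with h | h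
    · exact absurd ((hLx s).1 h) hs.not_gt
    · exact h

theorem TopologicalSpace.Opens.mem_of_mem_himp {X : Type*} [TopologicalSpace X] {U V : Opens X}
    {x : X} (h : x ∈ U ⇨ V) (hx : x ∈ U) : x ∈ V :=
  himp_inf_le (a := U) (b := V) ⟨h, hx⟩

theorem TopologicalSpace.Opens.mem_iff_of_mem_bihimp {X : Type*} [TopologicalSpace X]
    {U V : Opens X} {x : X} (h : x ∈ U ⇔ V) : x ∈ U ↔ x ∈ V :=
  ⟨Opens.mem_of_mem_himp h.2, Opens.mem_of_mem_himp h.1⟩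

theorem TopologicalSpace.Opens.mem_of_mem_iInf {X : Type*} [TopologicalSpace X] {ι : Sort*}
    {U : ι → Opens X} {x : X} (h : x ∈ ⨅ i, U i) (i : ι) : x ∈ U i :=
  iInf_le U i h

theorem TopologicalSpace.Opens.not_mem_of_mem_compl {X : Type*} [TopologicalSpace X]
    {U : Opens X} {x : X} (h : x ∈ Uᶜ) : x ∉ U := fun hx =>
  (disjoint_compl_right (a := U)).le_bot ⟨hx, h⟩

namespace HName

/-- At a point of the topological model where `L` and `R` form a Dedekind cut, the cut is
represented by a real number. -/
theorem exists_real_of_mem_isDedekind {X : Type} [TopologicalSpace X] {L R : HName (Opens X)}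
    {x : X} (h : x ∈ isDedekind L R) :
    ∃ t : ℝ, (∀ q : ℚ, x ∈ mem (rat q) L ↔ (q : ℝ) < t) ∧
      ∀ q : ℚ, x ∈ mem (rat q) R ↔ t < (q : ℝ) := by
  obtain ⟨⟨⟨⟨⟨hL, hR⟩, hLo⟩, hRo⟩, hdisj⟩, hloc⟩ := h
  refine exists_real_of_dedekind_cut (Opens.mem_iSup.1 hL) (Opens.mem_iSup.1 hR) ?_ ?_ ?_ ?_
  · intro q
    simpa using Opens.mem_iff_of_mem_bihimp (Opens.mem_of_mem_iInf hLo q)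
  · intro q
    simpa using Opens.mem_iff_of_mem_bihimp (Opens.mem_of_mem_iInf hRo q)
  · intro q
    exact Opens.not_mem_of_mem_compl (Opens.mem_of_mem_iInf hdisj q)
  · intro q r hqr
    exact Opens.mem_of_mem_iInf (Opens.mem_of_mem_iInf (Opens.mem_of_mem_iInf hloc q) r) hqr

/-- A name that is a Dedekind cut on `V` is given by a continuous real function on `V`. -/
theorem exists_continuousOn_of_le_isDedekind {X : Type} [TopologicalSpace X]
    {L R : HName (Opens X)} {V : Opens X} (hV : V ≤ isDedekind L R) :
    ∃ f : X → ℝ, ContinuousOn f V ∧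
      ∀ x ∈ V, (∀ q : ℚ, x ∈ mem (rat q) L → (q : ℝ) < f x) ∧
        ∀ q : ℚ, x ∈ mem (rat q) R → f x < (q : ℝ) := by
  choose! f hfL hfR using fun x (hx : x ∈ V) => exists_real_of_mem_isDedekind (hV hx)
  refine ⟨f, fun x hx => ?_, fun x hx => ⟨fun q => (hfL x hx q).1, fun q => (hfR x hx q).1⟩⟩
  refine ContinuousAt.continuousWithinAt ?_
  have hVx : ∀ᶠ y in nhds x, y ∈ V := V.isOpen.mem_nhds hx
  -- Truth values are open: those of `q ∈ L` give lower semicontinuity, those of `q ∈ R` upper.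
  refine tendsto_order.2 ⟨fun a ha => ?_, fun a ha => ?_⟩
  · obtain ⟨q, haq, hq⟩ := exists_rat_btwn ha
    filter_upwards [hVx, (mem (rat q) L).isOpen.mem_nhds ((hfL x hx q).2 hq)] with y hy hyq
    exact haq.trans ((hfL y hy q).1 hyq)
  · obtain ⟨q, hq, hqa⟩ := exists_rat_btwn ha
    filter_upwards [hVx, (mem (rat q) R).isOpen.mem_nhds ((hfR x hx q).2 hq)] with y hy hyq
    exact ((hfR y hy q).1 hyq).trans hqa

end HName

namespace FinSets

/-- Replace the point `a` of `A` by the pair of points `a + w` and `a - w`. -/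
def split (A : FinSets) (a w : ℂ) : FinSets :=
  ⟨(A.1 \ {a}) ∪ {a + w, a - w}, (A.2.1.sdiff).union (Set.toFinite _), ⟨a + w, by simp⟩⟩

theorem split_zero {A : FinSets} {a : ℂ} (ha : a ∈ A.1) : split A a 0 = A :=
  Subtype.ext (by simpa [split] using Set.insert_eq_of_mem ha)

/-- This symmetry makes the selected displacement an even function of `w`. -/
theorem split_neg (A : FinSets) (a w : ℂ) : split A a (-w) = split A a w :=
  Subtype.ext (by simp [split, Set.pair_comm, ← sub_eq_add_neg])

theorem continuous_split (A : FinSets) (a : ℂ) : Continuous (split A a) := by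
  have h1 : Continuous fun w : ℂ => a + w := by fun_prop
  have h2 : Continuous fun w : ℂ => a - w := by fun_prop
  refine continuous_induced_rng.2 (continuous_generateFrom_iff.2 ?_)
  rintro _ (⟨O, hO, rfl⟩ | ⟨O, hO, rfl⟩)
  · suffices h : IsOpen ({_w | A.1 \ {a} ⊆ O} ∩
        ((fun w => a + w) ⁻¹' O ∩ (fun w => a - w) ⁻¹' O)) by
      convert h using 1
      ext w
      change (A.1 \ {a}) ∪ {a + w, a - w} ⊆ O ↔ A.1 \ {a} ⊆ O ∧ a + w ∈ O ∧ a - w ∈ O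
      rw [Set.union_subset_iff, Set.insert_subset_iff, Set.singleton_subset_iff]
    exact isOpen_const.inter ((hO.preimage h1).inter (hO.preimage h2))
  · suffices h : IsOpen ({_w | ((A.1 \ {a}) ∩ O).Nonempty} ∪
        ((fun w => a + w) ⁻¹' O ∪ (fun w => a - w) ⁻¹' O)) by
      convert h using 1
      ext w
      change (((A.1 \ {a}) ∪ {a + w, a - w}) ∩ O).Nonempty ↔
        ((A.1 \ {a}) ∩ O).Nonempty ∨ a + w ∈ O ∨ a - w ∈ O
      rw [Set.union_inter_distrib_right, Set.union_nonempty, Set.insert_eq,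
        Set.union_inter_distrib_right, Set.union_nonempty, Set.singleton_inter_nonempty,
        Set.singleton_inter_nonempty]
    exact isOpen_const.union ((hO.preimage h1).union (hO.preimage h2))

/-- No non-empty open set of finite sets of complex numbers has a continuous selection: near a set
`A` with selected point `a`, splitting `a` into `a ± w` would give a continuous even square root
of `w ^ 2`. -/
theorem not_exists_continuousOn_selection {V : Opens FinSets} {A : FinSets} (hA : A ∈ V) :
    ¬ ∃ f : FinSets → ℂ, ContinuousOn f V ∧ ∀ B ∈ V, f B ∈ B.1 := by
  rintro ⟨f, hf, hsel⟩
  set a := f A with ha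
  have h0 : split A a 0 = A := split_zero (hsel A hA)
  have hcont : ContinuousAt (split A a) 0 := (continuous_split A a).continuousAt
  have hV : ∀ᶠ w in nhds (0 : ℂ), split A a w ∈ V :=
    hcont.eventually_mem (h0.symm ▸ V.isOpen.mem_nhds hA)
  have hfA : ContinuousAt f (split A a 0) := by
    rw [h0]; exact hf.continuousAt (V.isOpen.mem_nhds hA)
  -- The other points of `A` form a closed set missing `a`, so for small `w` the selected point can
  -- only be `a + w` or `a - w`.
  have hopen : (A.1 \ {a})ᶜ ∈ nhds (f (split A a 0)) := by
    rw [h0]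
    exact A.2.1.sdiff.isClosed.isOpen_compl.mem_nhds (by simp [ha])
  have hnear : ∀ᶠ w in nhds (0 : ℂ), f (split A a w) ∈ (A.1 \ {a})ᶜ :=
    (hfA.comp (f := split A a) hcont).eventually_mem hopen
  obtain ⟨ε, hε, hball⟩ := Metric.eventually_nhds_iff_ball.1 (hV.and hnear)
  have hsub : ∀ w ∈ Metric.sphere (0 : ℂ) (ε / 2), w ∈ Metric.ball (0 : ℂ) ε := fun w hw => by
    rw [Metric.mem_sphere] at hw
    rw [Metric.mem_ball, hw]; exact half_lt_self hε
  have hne : ∀ w ∈ Metric.sphere (0 : ℂ) (ε / 2), w ≠ 0 := fun w hw =>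
    Metric.ne_of_mem_sphere hw (half_pos hε).ne'
  have hpre : IsPreconnected (Metric.sphere (0 : ℂ) (ε / 2)) :=
    isPreconnected_sphere (by simp [Complex.rank_real_complex]) 0 _
  have hg : ContinuousOn (fun w => f (split A a w) - a) (Metric.sphere (0 : ℂ) (ε / 2)) :=
    (hf.comp (continuous_split A a).continuousOn fun w hw => (hball w (hsub w hw)).1).sub
      continuousOn_const
  have hsq : Set.EqOn ((fun w => f (split A a w) - a) ^ 2) ((fun w => w) ^ 2)
      (Metric.sphere (0 : ℂ) (ε / 2)) := by
    intro w hw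
    obtain ⟨h1, h2⟩ := hball w (hsub w hw)
    rcases hsel _ h1 with h | h | h
    · exact absurd h h2
    · simp [h]
    · rw [Set.mem_singleton_iff] at h
      simp [h]
  have hr : (((ε / 2 : ℝ) : ℂ)) ∈ Metric.sphere (0 : ℂ) (ε / 2) := by
    simp [abs_of_pos hε]
  have hr' : -(((ε / 2 : ℝ) : ℂ)) ∈ Metric.sphere (0 : ℂ) (ε / 2) := by
    simp [abs_of_pos hε]
  have hr0 := hne _ hr
  -- By connectedness of the circle one sign holds throughout, so the even displacement equals the
  -- odd function `w` or `-w`; compare its values at `±ε/2`.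
  rcases hpre.eq_or_eq_neg_of_sq_eq hg continuousOn_id hsq (fun {w} hw => hne w hw) with h | h <;>
  · have e1 := h hr
    have e2 := h hr'
    simp only [split_neg, Pi.neg_apply] at e1 e2
    exact hr0 (self_eq_neg.1 (by first | exact e1.symm.trans e2 | simpa using e2.symm.trans e1))

/-- The truth value of "`z` is a complex number in the generic set" is `⊥`. -/
theorem isComplex_inf_iInf_himp_inOpen_eq_bot (z : ComplexCode (Opens FinSets)) :
    z.isComplex ⊓ ⨅ (P : Finset (Opens ℂ)) (N : Opens ℂ), basicOpen P N ⇨ z.inOpen N = ⊥ := by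
  set V := z.isComplex ⊓ ⨅ (P : Finset (Opens ℂ)) (N : Opens ℂ), basicOpen P N ⇨ z.inOpen N
    with hVdef
  refine le_bot_iff.1 fun A hA => (not_exists_continuousOn_selection (V := V) hA ?_).elim
  have hV : V ≤ z.isComplex := inf_le_left
  obtain ⟨f, hf, hfz⟩ := HName.exists_continuousOn_of_le_isDedekind (hV.trans inf_le_left)
  obtain ⟨g, hg, hgz⟩ := HName.exists_continuousOn_of_le_isDedekind (hV.trans inf_le_right)
  refine ⟨fun B => f B + g B * Complex.I, by fun_prop, fun B hB => ?_⟩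
  -- If the value is not in `B`, then `B ⊆ N`, so some rational rectangle inside `N` contains the
  -- very point that `N` omits.
  set N : Opens ℂ := ⟨{f B + g B * Complex.I}ᶜ, isOpen_compl_singleton⟩
  by_contra hfB
  have hBN : B ∈ basicOpen ∅ N := by
    refine ⟨by simp, fun x hx hxB => hfB ?_⟩
    subst hxB
    exact hx
  have hin : B ∈ z.inOpen N :=
    Opens.mem_of_mem_himp (Opens.mem_of_mem_iInf (Opens.mem_of_mem_iInf hB.2 ∅) N) hBN
  simp only [ComplexCode.inOpen, Opens.mem_iSup] at hin
  obtain ⟨a, b, c, d, -, -, hsub, ⟨ha, hb⟩, hc, hd⟩ := hin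
  refine hsub (a := f B + g B * Complex.I) ?_ rfl
  have h := hfz B hB
  have h' := hgz B hB
  simpa [Complex.mem_reProdIm] using
    (⟨⟨h.1 a ha, h.2 b hb⟩, h'.1 c hc, h'.2 d hd⟩ : ((a : ℝ) < f B ∧ f B < b) ∧ _ ∧ _)

end FinSets

theorem theorem8 :
    FinSets.Forces ⊤ (⨆ X : HName (Opens FinSets), HName.mem X FinSets.genericH)ᶜ := by
  refine le_compl_comm.1 (le_trans (b := ⊥) ?_ bot_le)
  -- The equality of `X` with the name of `z` is discarded; the weight of `z` in `H` is already `⊥`.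
  refine (iSup_le fun X => iSup_le fun z => inf_le_left.trans ?_)
  exact (FinSets.isComplex_inf_iInf_himp_inOpen_eq_bot z).le
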